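/- Let $p$ be an odd prime and let $m_1<m_2<m_3<\cdots$ be positive integers. Let $T$ be the rooted tree whose vertices are the finite words $x_1x_2\cdots x_k$ with $x_i\in X_i=\{1,\dots,p^{m_i}\}$, and for $n\ge 0$ let $T_n$ be the tree of the same kind for the shifted sequence $m_{n+1},m_{n+2},\dots$ (so $T_0=T$). Let $\operatorname{St}(k)$ denote the subgroup of all automorphisms fixing every vertex of level $k$, and let $$\psi_1\colon \operatorname{St}_{\operatorname{Aut} T_n}(1)\longrightarrow \operatorname{Aut} T_{n+1}\times\overset{p^{m_{n+1}}}{\cdots}\times\operatorname{Aut} T_{n+1}$$ be the isomorphism sending an automorphism to the tuple of its sections at the first-level vertices. Let $\mathbf e=(e_1,\dots,e_{p^{m_1}-1})$ be a vector of integers with $|e_i|\le p^{m_2}-1$. For $n\ge 0$ let $a_n\in\operatorname{Aut}T_n$ be the rooted automorphism permuting the first letter by the cycle $(1\,2\,\cdots\,p^{m_{n+1}})$, let $b_n\in\operatorname{St}_{\operatorname{Aut}T_n}(1)$ be the directed automorphism defined recursively by $$\psi_1(b_n)=(a_{n+1}^{\,e_1},\dots,a_{n+1}^{\,e_{p^{m_1}-1}},1,\overset{p^{m_{n+1}}-p^{m_1}}{\dots},1,b_{n+1}),$$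 and put $G_n=\langle a_n,b_n\rangle$; the group $G=G_0$ is the growing GGS-group defined by $\mathbf e$. Assume that $\mathbf e$ is not the zero vector modulo $p$ and not constant modulo $p$ (that is, $e_i\not\equiv e_j \pmod p$ for some $i,j$), and that for all $n\ge 1$ $$\psi_1(G_{n-1}')\ \ge\ G_n'\times\overset{p^{m_n}}{\cdots}\times G_n'.$$ Then $G$ has the weak congruence subgroup property: for every subgroup $H$ of finite index in $G$ there is some $n$ such that $\operatorname{St}_G(n)'\le H$, where $\operatorname{St}_G(n)=G\cap\operatorname{St}(n)$. -/

import Mathlib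

namespace GrowingGGS

/-- Vertices of the spherically homogeneous rooted tree `T_k`: finite words whose `i`-th letter
(counting from `0`) lies in an alphabet with `d (k + i)` letters. For the tree `T = T_0` with
branching sequence `d 0, d 1, d 2, …`, this is the vertex set of the full subtree hanging from any
vertex of level `k` (with the prefix deleted). -/
inductive Vertex (d : ℕ → ℕ) : ℕ → Type
  | root {k : ℕ} : Vertex d k
  | cons {k : ℕ} (x : Fin (d k)) (v : Vertex d (k + 1)) : Vertex d k

namespace Vertex

variable {d : ℕ → ℕ}

/-- The length of a word, that is, the level of the vertex. -/
def length : {k : ℕ} → Vertex d k → ℕ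
  | _, root => 0
  | _, cons _ v => length v + 1

/-- `IsPrefix u v`: the word `u` is a prefix of the word `v`, that is, `u` lies on the path from
the root to `v`. -/
def IsPrefix : {k : ℕ} → Vertex d k → Vertex d k → Prop
  | _, root, _ => True
  | _, cons _ _, root => False
  | _, cons x u, cons y v => x = y ∧ IsPrefix u v

instance {k : ℕ} : LE (Vertex d k) := ⟨IsPrefix⟩

@[simp] theorem root_le {k : ℕ} (v : Vertex d k) : root ≤ v := by
  change IsPrefix root v
  simp [IsPrefix]

@[simp] theorem cons_le_root {k : ℕ} (x : Fin (d k)) (u : Vertex d (k + 1)) :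
    ¬ cons x u ≤ root := by
  change ¬ IsPrefix (cons x u) root
  simp [IsPrefix]

@[simp] theorem cons_le_cons {k : ℕ} (x y : Fin (d k)) (u v : Vertex d (k + 1)) :
    cons x u ≤ cons y v ↔ x = y ∧ u ≤ v := by
  change IsPrefix (cons x u) (cons y v) ↔ x = y ∧ IsPrefix u v
  simp [IsPrefix]

theorem le_root_iff {k : ℕ} (v : Vertex d k) : v ≤ root ↔ v = root := by
  cases v <;> simp

/-- The word with its first letter deleted (the empty word is sent to the empty word). -/
def tail : {k : ℕ} → Vertex d k → Vertex d (k + 1)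
  | _, root => root
  | _, cons _ v => v

theorem length_eq_one {k : ℕ} (v : Vertex d k) (h : v.length = 1) : ∃ x, v = cons x root := by
  cases v with
  | root => simp [length] at h
  | cons x v =>
    cases v with
    | root => exact ⟨x, rfl⟩
    | cons y w => simp [length] at h

end Vertex

open Vertex

/-- The group of automorphisms of the rooted tree `T_k`: the permutations of the vertices that
preserve and reflect the prefix relation. -/
abbrev AutT (d : ℕ → ℕ) (k : ℕ) : Type := Vertex d k ≃o Vertex d k

variable {d : ℕ → ℕ} {k : ℕ}

/-- The `n`-th level stabiliser in the full automorphism group of `T_k`: the automorphisms that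
fix all vertices of level `n`. -/
def levelStabilizer (d : ℕ → ℕ) (k n : ℕ) : Subgroup (AutT d k) where
  carrier := {f | ∀ v : Vertex d k, v.length = n → f v = v}
  one_mem' := fun _ _ => rfl
  mul_mem' := by
    intro f g hf hg v hv
    change f (g v) = v
    rw [hg v hv, hf v hv]
  inv_mem' := by
    intro f hf v hv
    change f.symm v = v
    rw [OrderIso.symm_apply_eq, hf v hv]

theorem apply_cons_of_mem {f : AutT d k} (hf : f ∈ levelStabilizer d k 1)
    (x : Fin (d k)) (v : Vertex d (k + 1)) : f (cons x v) = cons x (f (cons x v)).tail := by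
  have h1 : f (cons x root) = cons x root := hf _ (by simp [length])
  have h2 : cons x root ≤ f (cons x v) := by
    rw [← h1, f.le_iff_le]
    simp
  cases h : f (cons x v) with
  | root => rw [h] at h2; simp at h2
  | cons y w =>
    rw [h] at h2
    simp at h2
    simp [tail, h2]

/-- The section at the first-level vertex `x` of an automorphism `f` that fixes the first level:
`f (x v) = x (f_x v)`. -/
def firstSection (f : levelStabilizer d k 1) (x : Fin (d k)) : AutT d (k + 1) where
  toFun v := (f.1 (cons x v)).tail
  invFun v := ((f⁻¹).1 (cons x v)).tail
  left_inv v := by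
    dsimp only
    rw [← apply_cons_of_mem f.2]
    change (f.1.symm (f.1 (cons x v))).tail = v
    simp [tail]
  right_inv v := by
    dsimp only
    rw [← apply_cons_of_mem (f⁻¹).2]
    change (f.1 (f.1.symm (cons x v))).tail = v
    simp [tail]
  map_rel_iff' := by
    intro u v
    change (f.1 (cons x u)).tail ≤ (f.1 (cons x v)).tail ↔ u ≤ v
    have h : f.1 (cons x u) ≤ f.1 (cons x v) ↔ u ≤ v := by
      rw [f.1.le_iff_le]; simp
    rw [← h, apply_cons_of_mem f.2 x u, apply_cons_of_mem f.2 x v]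
    simp [tail]

/-- The underlying map of `assemble`. -/
def assembleFun (g : Fin (d k) → AutT d (k + 1)) : Vertex d k → Vertex d k
  | root => root
  | cons x v => cons x (g x v)

/-- The automorphism that fixes the first level and has prescribed first-level sections. -/
def assemble (g : Fin (d k) → AutT d (k + 1)) : AutT d k where
  toFun := assembleFun g
  invFun := assembleFun g⁻¹
  left_inv v := by
    cases v with
    | root => rfl
    | cons x v => simp only [assembleFun]; congr 1; exact (g x).symm_apply_apply v
  right_inv v := by
    cases v with
    | root => rfl
    | cons x v => simp only [assembleFun]; congr 1; exact (g x).apply_symm_apply v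
  map_rel_iff' := by
    intro u v
    change assembleFun g u ≤ assembleFun g v ↔ u ≤ v
    cases u with
    | root => simp [assembleFun]
    | cons x u =>
      cases v with
      | root => simp [assembleFun]
      | cons y v =>
        simp only [assembleFun, cons_le_cons]
        constructor
        · rintro ⟨rfl, h⟩; exact ⟨rfl, (g x).le_iff_le.1 h⟩
        · rintro ⟨rfl, h⟩; exact ⟨rfl, (g x).le_iff_le.2 h⟩

theorem assemble_mem (g : Fin (d k) → AutT d (k + 1)) : assemble g ∈ levelStabilizer d k 1 := by
  intro v hv
  obtain ⟨x, rfl⟩ := length_eq_one v hv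
  change cons x (g x root) = cons x root
  congr 1
  rw [← le_root_iff, ← (g x).symm.le_iff_le, (g x).symm_apply_apply]
  simp

theorem apply_root (f : AutT d k) : f root = root := by
  rw [← le_root_iff, ← f.symm.le_iff_le, f.symm_apply_apply]
  simp

/-- The isomorphism `ψ₁` from the first level stabiliser of `Aut T_k` onto the direct product of
copies of `Aut T_{k+1}` indexed by the first-level vertices, sending an automorphism to the tuple
of its first-level sections. -/
def psi₁ (d : ℕ → ℕ) (k : ℕ) : levelStabilizer d k 1 ≃* (Fin (d k) → AutT d (k + 1)) where
  toFun f := firstSection f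
  invFun g := ⟨assemble g, assemble_mem g⟩
  left_inv f := by
    apply Subtype.ext
    apply RelIso.ext
    intro v
    cases v with
    | root => exact (apply_root f.1).symm
    | cons x v => exact (apply_cons_of_mem f.2 x v).symm
  right_inv g := by
    funext x
    apply RelIso.ext
    intro v
    rfl
  map_mul' f g := by
    funext x
    apply RelIso.ext
    intro v
    change (f.1 (g.1 (cons x v))).tail = (f.1 (cons x (g.1 (cons x v)).tail)).tail
    rw [← apply_cons_of_mem g.2]

/-- The underlying map of `rooted`. -/
def rootedFun (s : Equiv.Perm (Fin (d k))) : Vertex d k → Vertex d k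
  | root => root
  | cons x v => cons (s x) v

/-- The rooted automorphism of `T_k` that permutes the first letters by `s`. -/
def rooted (s : Equiv.Perm (Fin (d k))) : AutT d k where
  toFun := rootedFun s
  invFun := rootedFun s⁻¹
  left_inv v := by cases v <;> simp [rootedFun]
  right_inv v := by cases v <;> simp [rootedFun]
  map_rel_iff' := by
    intro u v
    change rootedFun s u ≤ rootedFun s v ↔ u ≤ v
    cases u <;> cases v <;> simp [rootedFun]

/-- The branching sequence `p ^ m₁, p ^ m₂, …`; the sequence `m` is indexed from `0`, so that
`m i` stands for `m_{i+1}`. -/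
abbrev branching (p : ℕ) (m : ℕ → ℕ) : ℕ → ℕ := fun i => p ^ m i

/-- `a_n`, the rooted automorphism of `T_n` given by the cycle `(1 2 ⋯ p ^ m_{n+1})`. The letters
`1, 2, …` are represented by the elements `0, 1, …` of `Fin (p ^ m n)`. -/
def genA (p : ℕ) (m : ℕ → ℕ) (n : ℕ) : AutT (branching p m) n :=
  rooted (finRotate (branching p m n))

/-- The non-recursive part of the tuple of sections of `b_n`: the section at the letter `x`, for
`x` different from the last letter, is `a_{n+1} ^ e_x` if `x` is one of the first `p ^ m₁ - 1`
letters and trivial otherwise. -/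
def sectionB (p : ℕ) (m : ℕ → ℕ) (e : Fin (p ^ m 0 - 1) → ℤ) (n : ℕ)
    (x : Fin (branching p m n)) : AutT (branching p m) (n + 1) :=
  if h : (x : ℕ) < p ^ m 0 - 1 then genA p m (n + 1) ^ e ⟨x, h⟩ else 1

/-- The action on words of `b_n`: the section at the last letter is `b_{n+1}`, and the other
sections are given by `sectionB`. -/
def genBFun (p : ℕ) (m : ℕ → ℕ) (e : Fin (p ^ m 0 - 1) → ℤ) :
    {n : ℕ} → Vertex (branching p m) n → Vertex (branching p m) n
  | _, root => root
  | n, cons x v =>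
    cons x (if (x : ℕ) + 1 = branching p m n then genBFun p m e v else sectionB p m e n x v)

/-- The action on words of the inverse of `b_n`. -/
def genBInvFun (p : ℕ) (m : ℕ → ℕ) (e : Fin (p ^ m 0 - 1) → ℤ) :
    {n : ℕ} → Vertex (branching p m) n → Vertex (branching p m) n
  | _, root => root
  | n, cons x v =>
    cons x (if (x : ℕ) + 1 = branching p m n then genBInvFun p m e v
      else (sectionB p m e n x)⁻¹ v)

/-- `b_n`, the directed automorphism of `T_n` given by
`ψ₁(b_n) = (a_{n+1} ^ e₁, …, a_{n+1} ^ e_{p ^ m₁ - 1}, 1, …, 1, b_{n+1})`. -/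
def genB (p : ℕ) (m : ℕ → ℕ) (e : Fin (p ^ m 0 - 1) → ℤ) (n : ℕ) : AutT (branching p m) n where
  toFun := genBFun p m e
  invFun := genBInvFun p m e
  left_inv v := by
    induction v with
    | root => rfl
    | cons x v ih =>
      simp only [genBFun, genBInvFun]
      split_ifs with h
      · rw [ih]
      · congr 1
        exact (sectionB p m e _ x).symm_apply_apply v
  right_inv v := by
    induction v with
    | root => rfl
    | cons x v ih =>
      simp only [genBFun, genBInvFun]
      split_ifs with h
      · rw [ih]
      · congr 1
        exact (sectionB p m e _ x).apply_symm_apply v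
  map_rel_iff' := by
    intro u
    change ∀ v, genBFun p m e u ≤ genBFun p m e v ↔ u ≤ v
    induction u with
    | root => intro v; simp [genBFun]
    | cons x u ih =>
      intro v
      cases v with
      | root => simp [genBFun]
      | cons y v =>
        simp only [genBFun, cons_le_cons]
        refine and_congr_right ?_
        rintro rfl
        split_ifs with h
        · exact ih v
        · exact (sectionB p m e _ x).le_iff_le

theorem genB_mem (p : ℕ) (m : ℕ → ℕ) (e : Fin (p ^ m 0 - 1) → ℤ) (n : ℕ) :
    genB p m e n ∈ levelStabilizer (branching p m) n 1 := by
  intro v hv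
  obtain ⟨x, rfl⟩ := length_eq_one v hv
  change genBFun p m e (cons x root) = cons x root
  simp [genBFun, apply_root]

/-- The recursive definition of `b_n` through its first-level sections. -/
theorem psi₁_genB (p : ℕ) (m : ℕ → ℕ) (e : Fin (p ^ m 0 - 1) → ℤ) (n : ℕ) :
    psi₁ (branching p m) n ⟨genB p m e n, genB_mem p m e n⟩ =
      fun x : Fin (branching p m n) =>
      if (x : ℕ) + 1 = branching p m n then genB p m e (n + 1) else sectionB p m e n x := by
  funext x
  apply RelIso.ext
  intro v
  change (genBFun p m e (cons x v)).tail = _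
  simp only [genBFun, tail]
  split_ifs <;> rfl

/-- The shifted group `G_n = ⟨a_n, b_n⟩ ≤ Aut T_n`. The growing GGS-group with defining vector `e`
is `G = G_0`. -/
def growingGGS (p : ℕ) (m : ℕ → ℕ) (e : Fin (p ^ m 0 - 1) → ℤ) (n : ℕ) :
    Subgroup (AutT (branching p m) n) :=
  Subgroup.closure {genA p m n, genB p m e n}

/-- The image under `ψ₁` of (the elements fixing the first level of) a subgroup of `Aut T_k`. -/
def psi₁Image (K : Subgroup (AutT d k)) : Subgroup (Fin (d k) → AutT d (k + 1)) :=
  (K.subgroupOf (levelStabilizer d k 1)).map (psi₁ d k).toMonoidHom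

/-- The `n`-th level stabiliser `St_G(n)` as a subgroup of `G ≤ Aut T_k`. -/
def levelStabilizerIn (G : Subgroup (AutT d k)) (n : ℕ) : Subgroup G :=
  (levelStabilizer d k n).subgroupOf G

/-- The weak congruence subgroup property: every finite-index subgroup of `G` contains the
derived subgroup of some level stabiliser `St_G(n)`. -/
def HasWeakCSP (G : Subgroup (AutT d k)) : Prop :=
  ∀ H : Subgroup G, H.FiniteIndex →
    ∃ n : ℕ, ⁅levelStabilizerIn G n, levelStabilizerIn G n⁆ ≤ H

end GrowingGGS

/-! Let `N` be the normal core of a finite-index subgroup. Since `b` has infinite order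
(`genB_pow_ne_one`), a nontrivial power of `b` lies in `N` and moves some vertex `u`. If `R ≤ G` is
supported below `u`, an element of `N` moving `u` carries the support of `R` off itself, and the
usual double-commutator trick gives `R' ≤ N` (`commutator_le_of_apply_ne`). By the branching
hypothesis, `R` may be taken to be the copy of `G_n'` at `u`, where `n` is the level of `u`; so `N`
contains the copy of `G_n''` at `u`.

It remains to see that `G_n''` contains the derived subgroup of a level stabiliser. As `e` is not
constant modulo `p`, the elements of `G_n'` already have all of `G_{n+1}` as their sections at any
first-level vertex (`exists_mem_commutator_section_eq`). Commuting them with the copy of `G_{n+1}'`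
at that vertex puts a copy of `γ₃(G_{n+1})` into `G_n''` (`singleHom_mem_secondDerived`). Finally
`γ₃(G_{n+1})` contains `St(1)'`, because `St(1)` is cyclic modulo `G_{n+1}'`
(`commutator_stabilizer_le_lowerCentral`). Conjugation in `G` spreads this from `u` to its whole
level (`exists_subgroup_supported_below`). -/

namespace GrowingGGS

open Vertex
open scoped commutatorElement

/-! ### Two-generated groups modulo the lower central series -/

section Group

variable {Γ : Type*} [Group Γ]

open Subgroup in
/-- Elements of `⟨b⟩ Γ'` commute modulo the third term of the lower central series. -/
theorem commutatorElement_mem_of_mem_zpowers_sup (b : Γ) {x y : Γ}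
    (hx : x ∈ zpowers b ⊔ ⁅(⊤ : Subgroup Γ), (⊤ : Subgroup Γ)⁆) (hy : y ∈ zpowers b ⊔ ⁅(⊤ : Subgroup Γ), (⊤ : Subgroup Γ)⁆) :
    ⁅x, y⁆ ∈ ⁅⁅(⊤ : Subgroup Γ), (⊤ : Subgroup Γ)⁆, (⊤ : Subgroup Γ)⁆ := by
  obtain ⟨_, ⟨i, rfl⟩, c, hc, rfl⟩ := mem_sup_of_normal_right.1 hx
  obtain ⟨_, ⟨j, rfl⟩, c', hc', rfl⟩ := mem_sup_of_normal_right.1 hy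
  rw [← QuotientGroup.eq_one_iff, ← QuotientGroup.mk'_apply, map_commutatorElement,
    commutatorElement_eq_one_iff_commute]
  have central : ∀ z ∈ ⁅(⊤ : Subgroup Γ), (⊤ : Subgroup Γ)⁆, ∀ w : Γ,
      Commute (QuotientGroup.mk' ⁅⁅(⊤ : Subgroup Γ), (⊤ : Subgroup Γ)⁆, (⊤ : Subgroup Γ)⁆ z)
        (QuotientGroup.mk' _ w) := by
    intro z hz w
    rw [← commutatorElement_eq_one_iff_commute, ← map_commutatorElement, QuotientGroup.mk'_apply,
      QuotientGroup.eq_one_iff]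
    exact commutator_mem_commutator hz (mem_top w)
  simp only [map_mul, map_zpow]
  refine Commute.mul_left (Commute.mul_right ?_ ?_) (Commute.mul_right ?_ ?_)
  · exact (Commute.refl _).zpow_zpow i j
  · exact ((central c' hc' b).zpow_right i).symm
  · exact (central c hc b).zpow_right j
  · exact central c hc c'

-- The subgroup `⟨b⟩Γ'` contains `Γ'`, so it is normal, and the quotient by it is cyclic, generated
-- by the image of `a`.
open Subgroup in
theorem exists_zpow_mul_of_closure_eq_top {a b : Γ} (h : closure {a, b} = ⊤) (g : Γ) :
    ∃ i : ℤ, ∃ z ∈ zpowers b ⊔ ⁅(⊤ : Subgroup Γ), (⊤ : Subgroup Γ)⁆, g = a ^ i * z := by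
  have hn : (zpowers b ⊔ ⁅(⊤ : Subgroup Γ), (⊤ : Subgroup Γ)⁆).Normal :=
    Subgroup.Normal.of_commutator_le Γ le_sup_right
  have ht : zpowers a ⊔ (zpowers b ⊔ ⁅(⊤ : Subgroup Γ), (⊤ : Subgroup Γ)⁆) = ⊤ := by
    rw [eq_top_iff, ← h, closure_le]
    rintro x (rfl | rfl)
    · exact le_sup_left (a := zpowers x) (mem_zpowers x)
    · exact le_sup_right (a := zpowers a) (le_sup_left (a := zpowers x) (mem_zpowers x))
  obtain ⟨_, ⟨i, rfl⟩, z, hz, rfl⟩ := mem_sup_of_normal_right.1 (ht ▸ mem_top g)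
  exact ⟨i, z, hz, rfl⟩

theorem mem_of_zpow_mem_of_isCoprime {P : Subgroup Γ} {a : Γ} {r s : ℤ} (h : IsCoprime r s)
    (hr : a ^ r ∈ P) (hs : a ^ s = 1) : a ∈ P := by
  obtain ⟨u, v, huv⟩ := h
  have : (a ^ r) ^ u * (a ^ s) ^ v = a := by
    rw [← zpow_mul, ← zpow_mul, ← zpow_add, mul_comm r, mul_comm s, huv, zpow_one]
  rw [← this, hs, one_zpow, mul_one]
  exact P.zpow_mem hr u

end Group

/-! ### The prefix order and disjoint supports -/

namespace Vertex

variable {d : ℕ → ℕ}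

theorem length_le_of_le {k : ℕ} {u v : Vertex d k} (h : u ≤ v) :
    u.length ≤ v.length ∧ (u.length = v.length → u = v) := by
  induction u with
  | root => cases v <;> simp [length]
  | cons x u ih =>
    cases v with
    | root => simp at h
    | cons y v =>
      rw [cons_le_cons] at h
      obtain ⟨rfl, h⟩ := h
      obtain ⟨h1, h2⟩ := ih h
      exact ⟨Nat.succ_le_succ h1, fun h3 => by rw [h2 (Nat.succ_injective h3)]⟩

theorem le_total_of_le {k : ℕ} {u v w : Vertex d k} (hu : u ≤ w) (hv : v ≤ w) :
    u ≤ v ∨ v ≤ u := by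
  induction w with
  | root => simp [(le_root_iff u).1 hu]
  | cons z w ih =>
    cases u with
    | root => simp
    | cons x u =>
      cases v with
      | root => simp
      | cons y v =>
        rw [cons_le_cons] at hu hv
        obtain ⟨rfl, hu⟩ := hu
        obtain ⟨rfl, hv⟩ := hv
        simpa using ih hu hv

theorem exists_length_eq (hd : ∀ i, 0 < d i) (r k : ℕ) : ∃ v : Vertex d k, v.length = r := by
  induction r generalizing k with
  | zero => exact ⟨root, rfl⟩
  | succ r ih =>
    obtain ⟨v, hv⟩ := ih (k + 1)
    exact ⟨cons ⟨0, hd k⟩ v, by simp [length, hv]⟩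

end Vertex

variable {d : ℕ → ℕ} {k : ℕ}

/-- Levels are preserved, so an image cannot be a proper prefix. Induction on length replaces a
level-preservation lemma: a strictly shorter `g u` would itself be fixed by `g`, and injectivity
would give `g u = u`. -/
theorem apply_eq_of_apply_le (g : AutT d k) (u : Vertex d k) (h : g u ≤ u) : g u = u := by
  induction hn : u.length using Nat.strong_induction_on generalizing u with
  | _ n ih =>
    by_cases hl : (g u).length = u.length
    · exact (length_le_of_le h).2 hl
    · have hlt := lt_of_le_of_ne (length_le_of_le h).1 hl
      exact g.injective (ih _ (hn ▸ hlt) (g u) (g.le_iff_le.2 h) rfl)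

/-- A moved vertex and its image have no common descendant. -/
theorem not_le_of_apply_ne {g : AutT d k} {u : Vertex d k} (h : g u ≠ u) {w : Vertex d k}
    (hu : u ≤ w) : ¬ g u ≤ w := by
  intro hg
  rcases le_total_of_le hg hu with h1 | h1
  · exact h (apply_eq_of_apply_le g u h1)
  · refine h ?_
    have h2 : g⁻¹ u ≤ u := by
      rw [← g.le_iff_le]
      change g (g.symm u) ≤ g u
      rwa [g.apply_symm_apply]
    have h3 := apply_eq_of_apply_le g⁻¹ u h2
    exact (g.symm_apply_eq.1 h3).symm

theorem commute_of_disjoint {f g : AutT d k} (h : ∀ w, f w = w ∨ g w = w) : Commute f g := by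
  apply RelIso.ext
  intro w
  change f (g w) = g (f w)
  rcases h w with hf | hg
  · rw [hf]
    rcases h (g w) with h1 | h1
    · exact h1
    · rw [g.injective h1, hf]
  · rw [hg]
    rcases h (f w) with h1 | h1
    · rw [f.injective h1, hg]
    · exact h1.symm

/-! ### The wreath decomposition at the first level -/

/-- The automorphism with given first-level sections, as a homomorphism. -/
def assembleHom (d : ℕ → ℕ) (k : ℕ) : (Fin (d k) → AutT d (k + 1)) →* AutT d k :=
  (levelStabilizer d k 1).subtype.comp (psi₁ d k).symm.toMonoidHom

theorem assembleHom_apply_cons (t : Fin (d k) → AutT d (k + 1)) (x : Fin (d k))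
    (v : Vertex d (k + 1)) : assembleHom d k t (cons x v) = cons x (t x v) := rfl

theorem assembleHom_injective : Function.Injective (assembleHom d k) :=
  (Subtype.val_injective).comp (psi₁ d k).symm.injective

/-- Rooted automorphisms, as a homomorphism. -/
def rootedHom (d : ℕ → ℕ) (k : ℕ) : Equiv.Perm (Fin (d k)) →* AutT d k where
  toFun := rooted
  map_one' := by
    apply RelIso.ext
    intro v
    cases v <;> rfl
  map_mul' s t := by
    apply RelIso.ext
    intro v
    cases v <;> rfl

theorem rootedHom_apply_cons (s : Equiv.Perm (Fin (d k))) (x : Fin (d k))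
    (v : Vertex d (k + 1)) : rootedHom d k s (cons x v) = cons (s x) v := rfl

theorem rootedHom_mul_assembleHom (s : Equiv.Perm (Fin (d k)))
    (t : Fin (d k) → AutT d (k + 1)) :
    rootedHom d k s * assembleHom d k t = assembleHom d k (t ∘ ⇑s⁻¹) * rootedHom d k s := by
  apply RelIso.ext
  intro v
  cases v with
  | root => rfl
  | cons x v =>
    change cons (s x) (t x v) = cons (s x) (t (s.symm (s x)) v)
    rw [s.symm_apply_apply]

theorem rootedHom_injective : Function.Injective (rootedHom d k) := by
  intro s t h
  apply Equiv.ext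
  intro x
  have h1 := congrArg (fun f : AutT d k => f (cons x root)) h
  change cons (s x) root = cons (t x) root at h1
  exact (Vertex.cons.inj h1).1

theorem eq_one_of_rootedHom_mem {s : Equiv.Perm (Fin (d k))}
    (h : rootedHom d k s ∈ levelStabilizer d k 1) : s = 1 := by
  apply Equiv.ext
  intro x
  have h1 := h (cons x root) rfl
  exact (Vertex.cons.inj h1).1

/-- The automorphism acting as `g` below the first-level vertex `x` and trivially elsewhere. -/
def singleHom (x : Fin (d k)) : AutT d (k + 1) →* AutT d k :=
  (assembleHom d k).comp (MonoidHom.mulSingle (fun _ : Fin (d k) => AutT d (k + 1)) x)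

theorem singleHom_apply (x : Fin (d k)) (g : AutT d (k + 1)) :
    singleHom x g = assembleHom d k (Pi.mulSingle x g) := rfl

theorem rootedHom_conj_singleHom (s : Equiv.Perm (Fin (d k))) (x : Fin (d k))
    (g : AutT d (k + 1)) :
    rootedHom d k s * singleHom x g * (rootedHom d k s)⁻¹ = singleHom (s x) g := by
  rw [singleHom_apply, rootedHom_mul_assembleHom, mul_inv_cancel_right, singleHom_apply]
  congr 1
  funext y
  by_cases h : y = s x
  · subst h; simp
  · have : s⁻¹ y ≠ x := fun h' => h (by rw [← h']; exact (s.apply_symm_apply y).symm)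
    simp only [Function.comp_apply]
    rw [Pi.mulSingle_eq_of_ne h, Pi.mulSingle_eq_of_ne this]

theorem commutatorElement_singleHom_assembleHom (x : Fin (d k)) (g : AutT d (k + 1))
    (t : Fin (d k) → AutT d (k + 1)) :
    ⁅singleHom x g, assembleHom d k t⁆ = singleHom x ⁅g, t x⁆ := by
  rw [singleHom_apply, singleHom_apply, ← map_commutatorElement]
  congr 1
  funext y
  by_cases h : y = x
  · subst h; simp [commutatorElement_def]
  · simp [commutatorElement_def, Pi.mulSingle_eq_of_ne h]

theorem assembleHom_conj_singleHom (x : Fin (d k)) (g : AutT d (k + 1))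
    (t : Fin (d k) → AutT d (k + 1)) :
    assembleHom d k t * singleHom x g * (assembleHom d k t)⁻¹ =
      singleHom x (t x * g * (t x)⁻¹) := by
  rw [singleHom_apply, singleHom_apply, ← map_inv, ← map_mul, ← map_mul]
  congr 1
  funext y
  by_cases h : y = x
  · subst h; simp
  · simp [Pi.mulSingle_eq_of_ne h]

theorem assembleHom_mem_of_singleHom_mem {N : Subgroup (AutT d k)}
    (t : Fin (d k) → AutT d (k + 1)) (h : ∀ x, singleHom x (t x) ∈ N) :
    assembleHom d k t ∈ N :=
  Subgroup.pi_mem_of_mulSingle_mem (H := N.comap (assembleHom d k)) t h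

theorem singleHom_apply_of_not_le {x : Fin (d k)} {u : Vertex d (k + 1)} {g : AutT d (k + 1)}
    (h : ∀ w, ¬ u ≤ w → g w = w) (w : Vertex d k) (hw : ¬ cons x u ≤ w) :
    singleHom x g w = w := by
  cases w with
  | root => exact apply_root _
  | cons y w =>
    rw [singleHom_apply, assembleHom_apply_cons]
    by_cases hy : y = x
    · subst hy
      rw [Pi.mulSingle_eq_same, h w fun h' => hw (by simp [h'])]
    · rw [Pi.mulSingle_eq_of_ne hy]; rfl

/-- If `g` moves `u`, a subgroup normalised by `R` that contains `g` contains the commutators of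
the elements of `R`, provided that `R` is supported below `u`. -/
theorem commutator_le_of_apply_ne {N R : Subgroup (AutT d k)} {u : Vertex d k}
    (hR : ∀ f ∈ R, ∀ w, ¬ u ≤ w → f w = w)
    (hN : ∀ f ∈ R, ∀ h ∈ N, f * h * f⁻¹ ∈ N) {g : AutT d k} (hg : g ∈ N) (hgu : g u ≠ u) :
    ⁅R, R⁆ ≤ N := by
  rw [Subgroup.commutator_le]
  intro f hf h hh
  -- The conjugate is supported below `g u`, which is disjoint from the support of `h` below `u`.
  have hq : Commute (g * f⁻¹ * g⁻¹) h := by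
    apply commute_of_disjoint
    intro w
    by_cases hw : u ≤ w
    · left
      have h1 : ¬ u ≤ g⁻¹ w := by
        intro h2
        apply not_le_of_apply_ne hgu hw
        have h3 := g.le_iff_le.2 h2
        change g u ≤ g (g.symm w) at h3
        rwa [g.apply_symm_apply] at h3
      change g (f⁻¹ (g⁻¹ w)) = w
      rw [hR f⁻¹ (R.inv_mem hf) _ h1]
      exact g.apply_symm_apply w
    · right
      exact hR h hh w hw
  have h1 : f * (g * f⁻¹ * g⁻¹) ∈ N := by
    have := N.mul_mem (hN f hf g hg) (N.inv_mem hg)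
    simpa only [mul_assoc] using this
  -- Multiplying `f` on the right by an element commuting with `h` leaves `⁅f, h⁆` unchanged; this
  -- replaces `f` by `⁅f, g⁆ ∈ N`.
  have h2 : ⁅f, h⁆ = (f * (g * f⁻¹ * g⁻¹)) * (h * (f * (g * f⁻¹ * g⁻¹))⁻¹ * h⁻¹) := by
    have h3 : (g * f⁻¹ * g⁻¹) * h * (g * f⁻¹ * g⁻¹)⁻¹ = h := by
      rw [hq.eq, mul_inv_cancel_right]
    calc ⁅f, h⁆ = f * h * f⁻¹ * h⁻¹ := rfl
      _ = f * ((g * f⁻¹ * g⁻¹) * h * (g * f⁻¹ * g⁻¹)⁻¹) * f⁻¹ * h⁻¹ := by rw [h3]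
      _ = _ := by group
  rw [h2]
  exact N.mul_mem h1 (hN h hh _ (N.inv_mem h1))

/-! ### Sections and first level stabilisers of the groups `G_n` -/

section GGS

variable {p : ℕ} {m : ℕ → ℕ} {e : Fin (p ^ m 0 - 1) → ℤ} {n : ℕ}

theorem genA_eq_rootedHom : genA p m n = rootedHom (branching p m) n (finRotate _) := rfl

theorem genA_mem : genA p m n ∈ growingGGS p m e n :=
  Subgroup.subset_closure (Set.mem_insert _ _)

theorem genB_mem_growingGGS : genB p m e n ∈ growingGGS p m e n :=
  Subgroup.subset_closure (Set.mem_insert_of_mem _ rfl)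

theorem orderOf_genA (h : 2 ≤ branching p m n) : orderOf (genA p m n) = branching p m n := by
  rw [genA_eq_rootedHom, orderOf_injective _ rootedHom_injective,
    (isCycle_finRotate_of_le h).orderOf, support_finRotate_of_le h, Finset.card_univ,
    Fintype.card_fin]

/-- The tuple of first-level sections of `b_n`. -/
def sectionsB (p : ℕ) (m : ℕ → ℕ) (e : Fin (p ^ m 0 - 1) → ℤ) (n : ℕ)
    (x : Fin (branching p m n)) : AutT (branching p m) (n + 1) :=
  if (x : ℕ) + 1 = branching p m n then genB p m e (n + 1) else sectionB p m e n x

theorem genB_eq_assembleHom : genB p m e n = assembleHom _ n (sectionsB p m e n) := by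
  have h := congrArg (psi₁ (branching p m) n).symm (psi₁_genB p m e n)
  rw [MulEquiv.symm_apply_apply] at h
  exact congrArg Subtype.val h

theorem sectionsB_mem (x : Fin (branching p m n)) :
    sectionsB p m e n x ∈ growingGGS p m e (n + 1) := by
  unfold sectionsB sectionB
  split_ifs
  · exact genB_mem_growingGGS
  · exact Subgroup.zpow_mem _ genA_mem _
  · exact Subgroup.one_mem _

/-- Every element of `G_n` is an element of `St(1)` with sections in `G_{n+1}` times a power
of `a_n`. -/
theorem exists_assembleHom_mul_zpow {g : AutT (branching p m) n} (hg : g ∈ growingGGS p m e n) :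
    ∃ (i : ℤ) (t : Fin (branching p m n) → AutT (branching p m) (n + 1)),
      (∀ x, t x ∈ growingGGS p m e (n + 1)) ∧
      g = assembleHom _ n t * rootedHom _ n (finRotate (branching p m n) ^ i) := by
  induction hg using Subgroup.closure_induction with
  | mem g hg =>
    rcases hg with rfl | rfl
    · exact ⟨1, 1, fun _ => Subgroup.one_mem _, by
        rw [map_one, one_mul, zpow_one, genA_eq_rootedHom]⟩
    · exact ⟨0, sectionsB p m e n, sectionsB_mem, by
        rw [zpow_zero, map_one, mul_one, genB_eq_assembleHom]⟩
  | one => exact ⟨0, 1, fun _ => Subgroup.one_mem _, by simp⟩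
  | mul g h _ _ ihg ihh =>
    obtain ⟨i, t, ht, rfl⟩ := ihg
    obtain ⟨j, u, hu, rfl⟩ := ihh
    refine ⟨i + j, t * (u ∘ ⇑(finRotate (branching p m n) ^ i)⁻¹),
      fun x => Subgroup.mul_mem _ (ht x) (hu _), ?_⟩
    rw [zpow_add, map_mul, map_mul, mul_assoc, ← mul_assoc (rootedHom _ _ _) (assembleHom _ _ _),
      rootedHom_mul_assembleHom]
    simp only [mul_assoc]
  | inv g _ ih =>
    obtain ⟨i, t, ht, rfl⟩ := ih
    refine ⟨-i, t⁻¹ ∘ ⇑(finRotate (branching p m n) ^ (-i))⁻¹,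
      fun x => Subgroup.inv_mem _ (ht _), ?_⟩
    rw [← rootedHom_mul_assembleHom, mul_inv_rev, map_inv, zpow_neg, map_inv]

/-- The action on first letters is through powers of a single cycle, which commute. -/
theorem commutator_growingGGS_le_levelStabilizer :
    ⁅growingGGS p m e n, growingGGS p m e n⁆ ≤ levelStabilizer (branching p m) n 1 := by
  rw [Subgroup.commutator_le]
  intro g hg h hh v hv
  obtain ⟨x, rfl⟩ := length_eq_one v hv
  set c := finRotate (branching p m n) with hc
  have key : ∀ {f : AutT (branching p m) n} {i : ℤ}
      {t : Fin (branching p m n) → AutT (branching p m) (n + 1)},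
      f = assembleHom _ n t * rootedHom _ n (c ^ i) →
      ∀ y, f (cons y root) = cons ((c ^ i) y) root := by
    rintro f i t rfl y
    change assembleHom _ n t (rootedHom _ n (c ^ i) (cons y root)) = _
    rw [rootedHom_apply_cons, assembleHom_apply_cons, apply_root]
  obtain ⟨i, t, -, hgi⟩ := exists_assembleHom_mul_zpow hg
  obtain ⟨j, u, -, hhj⟩ := exists_assembleHom_mul_zpow hh
  obtain ⟨y, rfl⟩ := (c ^ (j + i)).surjective x
  have h1 : (g * h) (cons y root) = cons ((c ^ (j + i)) y) root := by
    change g (h (cons y root)) = _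
    rw [key hhj, key hgi, ← Equiv.Perm.mul_apply, ← zpow_add, add_comm]
  have h2 : (h * g) (cons y root) = cons ((c ^ (j + i)) y) root := by
    change h (g (cons y root)) = _
    rw [key hgi, key hhj, ← Equiv.Perm.mul_apply, ← zpow_add]
  rw [commutatorElement_def, show g * h * g⁻¹ * h⁻¹ = g * h * (h * g)⁻¹ by group]
  nth_rewrite 1 [← h2]
  change (g * h) ((h * g).symm ((h * g) _)) = _
  rw [OrderIso.symm_apply_apply, h1]

/-- The sections of an element of `St_{G_n}(r+1)` lie in `St_{G_{n+1}}(r)`. -/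
theorem exists_eq_assembleHom_of_mem_levelStabilizer (hd : ∀ i, 0 < branching p m i) {r : ℕ}
    {g : AutT (branching p m) n} (hg : g ∈ growingGGS p m e n)
    (hr : g ∈ levelStabilizer (branching p m) n (r + 1)) :
    ∃ t, (∀ x, t x ∈ growingGGS p m e (n + 1) ⊓ levelStabilizer (branching p m) (n + 1) r) ∧
      g = assembleHom _ n t := by
  obtain ⟨i, t, ht, rfl⟩ := exists_assembleHom_mul_zpow hg
  have key : ∀ x v, v.length = r →
      cons ((finRotate (branching p m n) ^ i) x) (t ((finRotate (branching p m n) ^ i) x) v) =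
        cons x v := fun x v hv => hr (cons x v) (by rw [length, hv])
  -- A word of length `r` exists below every letter; fixing its extension already fixes that letter.
  have hs : finRotate (branching p m n) ^ i = 1 := by
    apply Equiv.ext
    intro x
    obtain ⟨v, hv⟩ := exists_length_eq hd r (n + 1)
    exact (Vertex.cons.inj (key x v hv)).1
  rw [hs] at key ⊢
  exact ⟨t, fun x => ⟨ht x, fun v hv => eq_of_heq (by simpa using key x v hv)⟩, by simp⟩

/-- Write an element of `St(1)` as `a ^ i * z` with `z ∈ ⟨b⟩G_n'`. Then `a ^ i` is rooted and fixes
the first level, hence is trivial. So `St(1)` lies in `⟨b⟩G_n'`, whose elements commute modulo `γ₃`.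
-/
theorem commutator_stabilizer_le_lowerCentral :
    ⁅growingGGS p m e n ⊓ levelStabilizer (branching p m) n 1,
      growingGGS p m e n ⊓ levelStabilizer (branching p m) n 1⁆ ≤
    ⁅⁅growingGGS p m e n, growingGGS p m e n⁆, growingGGS p m e n⁆ := by
  set G := growingGGS p m e n with hG
  have htop : (⊤ : Subgroup G).map G.subtype = G := by
    rw [← MonoidHom.range_eq_map, Subgroup.range_subtype]
  have hcomm : (⁅(⊤ : Subgroup G), (⊤ : Subgroup G)⁆).map G.subtype = ⁅G, G⁆ := by
    rw [Subgroup.map_commutator, htop]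
  let a : G := ⟨genA p m n, genA_mem⟩
  let b : G := ⟨genB p m e n, genB_mem_growingGGS⟩
  have hab : Subgroup.closure {a, b} = ⊤ := by
    apply Subgroup.map_injective G.subtype_injective
    rw [htop, MonoidHom.map_closure, Set.image_pair]
    rfl
  have hB : ∀ g (hg : g ∈ G), g ∈ levelStabilizer (branching p m) n 1 →
      (⟨g, hg⟩ : G) ∈ Subgroup.zpowers b ⊔ ⁅(⊤ : Subgroup G), (⊤ : Subgroup G)⁆ := by
    intro g hg hst
    obtain ⟨i, z, hz, hgz⟩ := exists_zpow_mul_of_closure_eq_top hab ⟨g, hg⟩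
    have hle : (Subgroup.zpowers b ⊔ ⁅(⊤ : Subgroup G), (⊤ : Subgroup G)⁆) ≤
        (levelStabilizer (branching p m) n 1).subgroupOf G := by
      rw [sup_le_iff, Subgroup.zpowers_le]
      refine ⟨genB_mem p m e n, ?_⟩
      rw [Subgroup.subgroupOf, ← Subgroup.map_le_iff_le_comap, hcomm]
      exact commutator_growingGGS_le_levelStabilizer
    have hai : (a ^ i : G).1 = 1 := by
      have h1 : (a ^ i : G).1 ∈ levelStabilizer (branching p m) n 1 := by
        have h2 : a ^ i = ⟨g, hg⟩ * z⁻¹ := by rw [hgz, mul_inv_cancel_right]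
        rw [h2]
        exact Subgroup.mul_mem _ hst (Subgroup.inv_mem _ (hle hz))
      have h3 : (a ^ i : G).1 = rootedHom _ n (finRotate (branching p m n) ^ i) := by
        rw [map_zpow]; rfl
      rw [h3] at h1 ⊢
      rw [eq_one_of_rootedHom_mem h1, map_one]
    rw [hgz, show a ^ i = 1 from Subtype.ext hai, one_mul]
    exact hz
  rw [Subgroup.commutator_le]
  rintro g ⟨hg, hg1⟩ h ⟨hh, hh1⟩
  have := commutatorElement_mem_of_mem_zpowers_sup b (hB g hg hg1) (hB h hh hh1)
  have := Subgroup.mem_map_of_mem G.subtype this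
  rwa [Subgroup.map_commutator, hcomm, htop] at this

theorem singleHom_mem_commutator (hbranch : ∀ n : ℕ,
      Subgroup.pi Set.univ (fun _ : Fin (p ^ m n) =>
          ⁅growingGGS p m e (n + 1), growingGGS p m e (n + 1)⁆) ≤
        psi₁Image ⁅growingGGS p m e n, growingGGS p m e n⁆) (x : Fin (branching p m n))
    {c : AutT (branching p m) (n + 1)}
    (hc : c ∈ ⁅growingGGS p m e (n + 1), growingGGS p m e (n + 1)⁆) :
    singleHom x c ∈ ⁅growingGGS p m e n, growingGGS p m e n⁆ := by
  have h : Pi.mulSingle x c ∈ Subgroup.pi Set.univ (fun _ : Fin (p ^ m n) =>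
      ⁅growingGGS p m e (n + 1), growingGGS p m e (n + 1)⁆) := by
    intro y _
    by_cases hy : y = x
    · subst hy; rwa [Pi.mulSingle_eq_same]
    · rw [Pi.mulSingle_eq_of_ne hy]; exact Subgroup.one_mem _
  obtain ⟨f, hf, hfx⟩ := hbranch n h
  rw [singleHom_apply, ← hfx]
  have : assembleHom (branching p m) n ((psi₁ (branching p m) n) f) = f.1 :=
    congrArg Subtype.val ((psi₁ (branching p m) n).symm_apply_apply f)
  exact this ▸ hf

end GGS

/-! ### Every element of `G_{n+1}` is a section of an element of `G_n'` -/

theorem coe_finRotate_of_lt {N : ℕ} (x : Fin N) (h : (x : ℕ) + 1 < N) :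
    (finRotate N x : ℕ) = x + 1 := by
  obtain ⟨N, rfl⟩ : ∃ M, N = M + 1 := ⟨N - 1, by omega⟩
  obtain ⟨x, hx⟩ := x
  rw [finRotate_of_lt (by simpa using h)]

theorem exists_finRotate_zpow_eq {N : ℕ} (hN : 2 ≤ N) (x y : Fin N) :
    ∃ i : ℤ, (finRotate N ^ i) x = y := by
  have h : ∀ z, finRotate N z ≠ z := fun z => by
    rw [← Equiv.Perm.mem_support, support_finRotate_of_le hN]
    exact Finset.mem_univ z
  exact (isCycle_finRotate_of_le hN).exists_zpow_eq (h x) (h y)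

section GGS

variable {p : ℕ} {m : ℕ → ℕ} {e : Fin (p ^ m 0 - 1) → ℤ} {n : ℕ}

theorem genA_zpow (i : ℤ) :
    genA p m n ^ i = rootedHom _ n (finRotate (branching p m n) ^ i) := by
  rw [map_zpow]; rfl

theorem singleHom_mem_of_singleHom_mem (hN : 2 ≤ branching p m n)
    {N : Subgroup (AutT (branching p m) n)}
    (hG : ∀ g ∈ growingGGS p m e n, ∀ h ∈ N, g * h * g⁻¹ ∈ N)
    {x : Fin (branching p m n)} {g : AutT (branching p m) (n + 1)}
    (h : singleHom x g ∈ N) (y : Fin (branching p m n)) : singleHom y g ∈ N := by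
  obtain ⟨i, rfl⟩ := exists_finRotate_zpow_eq hN x y
  rw [← rootedHom_conj_singleHom, ← genA_zpow]
  exact hG _ (Subgroup.zpow_mem _ genA_mem i) _ h

/-- The projection of `G_n' ∩ St(1)` to the first-level vertex `x`. -/
def commutatorProjection (p : ℕ) (m : ℕ → ℕ) (e : Fin (p ^ m 0 - 1) → ℤ) (n : ℕ)
    (x : Fin (branching p m n)) : Subgroup (AutT (branching p m) (n + 1)) :=
  (⁅growingGGS p m e n, growingGGS p m e n⁆.comap (assembleHom (branching p m) n)).map
    (Pi.evalMonoidHom _ x)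

theorem conj_mem_commutator {Γ : Type*} [Group Γ] {G : Subgroup Γ} {g h : Γ} (hg : g ∈ G)
    (hh : h ∈ ⁅G, G⁆) : g * h * g⁻¹ ∈ ⁅G, G⁆ := by
  have h1 := Subgroup.commutator_mem_commutator hg (G.commutator_le_self hh)
  have h2 := Subgroup.mul_mem _ h1 hh
  rwa [commutatorElement_def, inv_mul_cancel_right] at h2

/-- Powers of `a_n` normalise `G_n'` and permute the first-level vertices transitively. -/
theorem commutatorProjection_le (hN : 2 ≤ branching p m n) (x y : Fin (branching p m n)) :
    commutatorProjection p m e n x ≤ commutatorProjection p m e n y := by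
  obtain ⟨i, rfl⟩ := exists_finRotate_zpow_eq hN x y
  rintro _ ⟨t, ht, rfl⟩
  refine ⟨t ∘ ⇑(finRotate (branching p m n) ^ i)⁻¹, ?_, ?_⟩
  · have h1 := conj_mem_commutator (Subgroup.zpow_mem _ (genA_mem (e := e)) i) ht
    rw [genA_zpow, rootedHom_mul_assembleHom, mul_inv_cancel_right] at h1
    exact h1
  · exact congrArg t ((finRotate (branching p m n) ^ i).symm_apply_apply x)

/-- These are the sections of `⁅b⁻¹, a⁆ = b⁻¹ * (a * b * a⁻¹)`: conjugation by `a` shifts the tuple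
of sections of `b` by one place. -/
theorem sectionsB_mul_mem_commutatorProjection (hN : 2 ≤ branching p m n)
    (x y : Fin (branching p m n)) :
    (sectionsB p m e n (finRotate _ y))⁻¹ * sectionsB p m e n y ∈
      commutatorProjection p m e n x := by
  apply commutatorProjection_le hN (finRotate _ y) x
  refine ⟨(sectionsB p m e n)⁻¹ * (sectionsB p m e n ∘ ⇑(finRotate (branching p m n))⁻¹), ?_, ?_⟩
  · have h1 := Subgroup.commutator_mem_commutator
      (Subgroup.inv_mem _ (genB_mem_growingGGS (p := p) (m := m) (e := e) (n := n)))
      (genA_mem (e := e))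
    rw [commutatorElement_def, inv_inv, mul_assoc _ (genA p m n), genA_eq_rootedHom,
      genB_eq_assembleHom, mul_assoc, rootedHom_mul_assembleHom, mul_inv_cancel_right, ← map_inv,
      ← map_mul] at h1
    exact h1
  · change _ * sectionsB p m e n ((finRotate (branching p m n)).symm (finRotate _ y)) = _
    rw [Equiv.symm_apply_apply]
    rfl

/-- Neighbouring entries are needed because `⁅b⁻¹, a⁆` only compares sections at consecutive
letters. -/
theorem exists_succ_not_modEq {N : ℕ} {e : Fin N → ℤ} {q : ℤ}
    (h : ∃ i j, ¬ e i ≡ e j [ZMOD q]) :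
    ∃ (i : ℕ) (hi : i + 1 < N), ¬ e ⟨i, by omega⟩ ≡ e ⟨i + 1, hi⟩ [ZMOD q] := by
  by_contra! hc
  obtain ⟨i, j, hij⟩ := h
  have h0 : ∀ (i : ℕ) (hi : i < N), e ⟨i, hi⟩ ≡ e ⟨0, by omega⟩ [ZMOD q] := by
    intro i
    induction i with
    | zero => exact fun _ => Int.ModEq.refl _
    | succ i ih => exact fun hi => (hc i hi).symm.trans (ih (by omega))
  exact hij ((h0 i i.2).trans (h0 j j.2).symm)

theorem two_le_branching (hp : p.Prime) (hm_pos : 0 < m 0) (hm : StrictMono m) (n : ℕ) :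
    2 ≤ branching p m n :=
  hp.two_le.trans (Nat.le_self_pow (by have := hm.monotone (Nat.zero_le n); omega) p)

theorem genA_zpow_branching (hN : 2 ≤ branching p m n) :
    genA p m n ^ ((p : ℤ) ^ m n) = 1 := by
  have := pow_orderOf_eq_one (genA p m n)
  rw [orderOf_genA hN] at this
  exact_mod_cast this

theorem sectionsB_of_lt (hm : StrictMono m) (hp : 0 < p) {x : Fin (branching p m n)}
    (hx : (x : ℕ) < p ^ m 0 - 1) : sectionsB p m e n x = genA p m (n + 1) ^ e ⟨x, hx⟩ := by
  have h1 : p ^ m 0 ≤ branching p m n := Nat.pow_le_pow_right hp (hm.monotone (Nat.zero_le n))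
  rw [sectionsB, if_neg (by omega), sectionB, dif_pos hx]

theorem sectionsB_of_last {x : Fin (branching p m n)} (hx : (x : ℕ) + 1 = branching p m n) :
    sectionsB p m e n x = genB p m e (n + 1) := by
  rw [sectionsB, if_pos hx]

/-- Every element of `G_{n+1}` is the section at `x` of an element of `G_n'`. -/
theorem exists_mem_commutator_section_eq (hp : p.Prime) (hm_pos : 0 < m 0) (hm : StrictMono m)
    (he_nonconst : ∃ i j, ¬ e i ≡ e j [ZMOD p]) (x : Fin (branching p m n))
    {g : AutT (branching p m) (n + 1)} (hg : g ∈ growingGGS p m e (n + 1)) :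
    ∃ t, assembleHom _ n t ∈ ⁅growingGGS p m e n, growingGGS p m e n⁆ ∧ t x = g := by
  have hN := two_le_branching hp hm_pos hm n
  have hle : p ^ m 0 ≤ branching p m n :=
    Nat.pow_le_pow_right hp.pos (hm.monotone (Nat.zero_le n))
  suffices h : growingGGS p m e (n + 1) ≤ commutatorProjection p m e n x from h hg
  have ha : genA p m (n + 1) ∈ commutatorProjection p m e n x := by
    obtain ⟨i, hi, hij⟩ := exists_succ_not_modEq he_nonconst
    have h1 := sectionsB_mul_mem_commutatorProjection (e := e) hN x ⟨i, by omega⟩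
    have hrot : finRotate (branching p m n) ⟨i, by omega⟩ = ⟨i + 1, by omega⟩ :=
      Fin.ext (coe_finRotate_of_lt _ (by simp only; omega))
    rw [hrot, sectionsB_of_lt hm hp.pos (x := ⟨i, _⟩) (by simp only; omega),
      sectionsB_of_lt hm hp.pos (x := ⟨i + 1, _⟩) hi,
      ← zpow_neg, ← zpow_add] at h1
    -- The projection contains `a` to the power `e_i - e_{i+1}`, which is prime to the `p`-power
    -- order of `a`.
    refine mem_of_zpow_mem_of_isCoprime ?_ h1 (genA_zpow_branching (two_le_branching hp hm_pos hm _))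
    apply IsCoprime.pow_right
    rw [isCoprime_comm, (Nat.prime_iff_prime_int.1 hp).coprime_iff_not_dvd]
    intro hdvd
    apply hij
    apply (Int.modEq_iff_dvd.2 _).symm
    rwa [neg_add_eq_sub] at hdvd
  rw [growingGGS, Subgroup.closure_le]
  rintro _ (rfl | rfl)
  · exact ha
  -- At the last two letters the quotient of sections is `b⁻¹` times a power of `a`, and `a` is
  -- already available.
  · have h1 := sectionsB_mul_mem_commutatorProjection (e := e) hN x
      ⟨branching p m n - 2, by omega⟩
    have hrot : (finRotate (branching p m n) ⟨branching p m n - 2, by omega⟩ : ℕ) + 1 =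
        branching p m n := by
      rw [coe_finRotate_of_lt _ (by simp only; omega)]
      simp only
      omega
    rw [sectionsB_of_last hrot] at h1
    have h2 : sectionsB p m e n ⟨branching p m n - 2, by omega⟩ ∈
        commutatorProjection p m e n x := by
      rw [sectionsB, if_neg (by simp only; omega), sectionB]
      split_ifs
      · exact Subgroup.zpow_mem _ ha _
      · exact Subgroup.one_mem _
    have h3 := Subgroup.mul_mem _ h2 (Subgroup.inv_mem _ h1)
    rwa [mul_inv_rev, inv_inv, mul_inv_cancel_left] at h3

/-! ### From `G_n''` to derived subgroups of level stabilisers -/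

/-- A commutator with an element supported below `x` only sees the section at `x` of the other
entry. That section may be any `g ∈ G_{n+1}`, although the entry itself stays in `G_n'`. -/
theorem singleHom_mem_secondDerived
    (hsec : ∀ (n : ℕ) (x : Fin (branching p m n)), ∀ g ∈ growingGGS p m e (n + 1),
      ∃ t, assembleHom _ n t ∈ ⁅growingGGS p m e n, growingGGS p m e n⁆ ∧ t x = g)
    (hsingle : ∀ (n : ℕ) (x : Fin (branching p m n)),
      ∀ c ∈ ⁅growingGGS p m e (n + 1), growingGGS p m e (n + 1)⁆,
      singleHom x c ∈ ⁅growingGGS p m e n, growingGGS p m e n⁆)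
    (x : Fin (branching p m n)) {c : AutT (branching p m) (n + 1)}
    (hc : c ∈ ⁅⁅growingGGS p m e (n + 1), growingGGS p m e (n + 1)⁆,
      growingGGS p m e (n + 1)⁆) :
    singleHom x c ∈ ⁅⁅growingGGS p m e n, growingGGS p m e n⁆,
      ⁅growingGGS p m e n, growingGGS p m e n⁆⁆ := by
  have h : ⁅⁅growingGGS p m e (n + 1), growingGGS p m e (n + 1)⁆, growingGGS p m e (n + 1)⁆ ≤
      ⁅⁅growingGGS p m e n, growingGGS p m e n⁆,
        ⁅growingGGS p m e n, growingGGS p m e n⁆⁆.comap (singleHom x) := by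
    rw [Subgroup.commutator_le]
    intro c hc g hg
    obtain ⟨t, ht, rfl⟩ := hsec n x g hg
    rw [Subgroup.mem_comap, ← commutatorElement_singleHom_assembleHom]
    exact Subgroup.commutator_mem_commutator (hsingle n x c hc) ht
  exact h hc

/-- The derived subgroup of `St_{G_n}(r+1)` lies in `N` if, at each first-level vertex, `N`
contains the derived subgroup of `St_{G_{n+1}}(r)`. -/
theorem commutator_stabilizer_succ_le (hd : ∀ i, 0 < branching p m i) {r : ℕ}
    {N : Subgroup (AutT (branching p m) n)}
    (h : ∀ x : Fin (branching p m n),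
      ⁅growingGGS p m e (n + 1) ⊓ levelStabilizer (branching p m) (n + 1) r,
        growingGGS p m e (n + 1) ⊓ levelStabilizer (branching p m) (n + 1) r⁆ ≤
      N.comap (singleHom x)) :
    ⁅growingGGS p m e n ⊓ levelStabilizer (branching p m) n (r + 1),
      growingGGS p m e n ⊓ levelStabilizer (branching p m) n (r + 1)⁆ ≤ N := by
  rw [Subgroup.commutator_le]
  rintro f ⟨hf, hfr⟩ g ⟨hg, hgr⟩
  obtain ⟨t, ht, rfl⟩ := exists_eq_assembleHom_of_mem_levelStabilizer hd hf hfr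
  obtain ⟨u, hu, rfl⟩ := exists_eq_assembleHom_of_mem_levelStabilizer hd hg hgr
  rw [← map_commutatorElement]
  exact assembleHom_mem_of_singleHom_mem _ fun x =>
    h x (Subgroup.commutator_mem_commutator (ht x) (hu x))

/-- Below every vertex `u` there is a subgroup `R` of `G_n'` such that any subgroup normalised
by `G_n` containing `R'` contains the derived subgroup of a level stabiliser. -/
theorem exists_subgroup_supported_below (hN : ∀ i, 2 ≤ branching p m i)
    (hsec : ∀ (n : ℕ) (x : Fin (branching p m n)), ∀ g ∈ growingGGS p m e (n + 1),
      ∃ t, assembleHom _ n t ∈ ⁅growingGGS p m e n, growingGGS p m e n⁆ ∧ t x = g)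
    (hsingle : ∀ (n : ℕ) (x : Fin (branching p m n)),
      ∀ c ∈ ⁅growingGGS p m e (n + 1), growingGGS p m e (n + 1)⁆,
      singleHom x c ∈ ⁅growingGGS p m e n, growingGGS p m e n⁆)
    (u : Vertex (branching p m) n) :
    ∃ R : Subgroup (AutT (branching p m) n), R ≤ ⁅growingGGS p m e n, growingGGS p m e n⁆ ∧
      (∀ f ∈ R, ∀ w, ¬ u ≤ w → f w = w) ∧
      ∃ r, ∀ N : Subgroup (AutT (branching p m) n),
        (∀ g ∈ growingGGS p m e n, ∀ h ∈ N, g * h * g⁻¹ ∈ N) → ⁅R, R⁆ ≤ N →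
        ⁅growingGGS p m e n ⊓ levelStabilizer (branching p m) n r,
          growingGGS p m e n ⊓ levelStabilizer (branching p m) n r⁆ ≤ N := by
  have hd : ∀ i, 0 < branching p m i := fun i => two_pos.trans_le (hN i)
  induction u with
  | @root n =>
    -- Here `R = G_n'`. The level is `2`: one step down to reach `γ₃(G_{n+1})`, and one more since
    -- that contains `St(1)'`.
    refine ⟨_, le_rfl, fun f _ w hw => absurd (root_le w) hw, 2, fun N _ hR => ?_⟩
    exact commutator_stabilizer_succ_le hd fun x c hc => hR <|
      singleHom_mem_secondDerived hsec hsingle x (commutator_stabilizer_le_lowerCentral hc)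
  | @cons n x u ih =>
    obtain ⟨R, hRle, hRu, r, hr⟩ := ih
    refine ⟨R.map (singleHom x), ?_, ?_, r + 1, fun N hG hR => ?_⟩
    · rw [Subgroup.map_le_iff_le_comap]
      exact fun c hc => hsingle n x c (hRle hc)
    · rintro _ ⟨f, hf, rfl⟩ w hw
      exact singleHom_apply_of_not_le (hRu f hf) w hw
    -- The induction hypothesis is applied at every `y`, not only at `x`: the part of `N` at `y` is
    -- normalised by `G_{n+1}` because each element of it is a section at `y`, and it contains `R'`
    -- by rotating `x` to `y`.
    · refine commutator_stabilizer_succ_le hd fun y => hr _ ?_ ?_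
      · intro g hg h hh
        obtain ⟨t, ht, rfl⟩ := hsec n y g hg
        rw [Subgroup.mem_comap, ← assembleHom_conj_singleHom]
        exact hG _ (Subgroup.commutator_le_self _ ht) _ hh
      · intro c hc
        refine singleHom_mem_of_singleHom_mem (x := x) (hN n) hG (hR ?_) y
        rw [← Subgroup.map_commutator]
        exact Subgroup.mem_map_of_mem _ hc

/-! ### Infinite order of `b_n` and the conclusion -/

/-- `b_n` has infinite order. -/
theorem genB_pow_ne_one (hp : p.Prime) (hm_pos : 0 < m 0) (hm : StrictMono m)
    (he_nonzero : ∃ i, ¬ e i ≡ 0 [ZMOD p]) {j : ℕ} (hj : j ≠ 0) : genB p m e n ^ j ≠ 1 := by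
  intro h
  have hsect : ∀ k, genB p m e k ^ j = 1 → ∀ x, sectionsB p m e k x ^ j = 1 := by
    intro k hk x
    rw [genB_eq_assembleHom, ← map_pow, ← map_one (assembleHom (branching p m) k)] at hk
    exact congrFun (assembleHom_injective hk) x
  have hall : ∀ k, genB p m e (n + k) ^ j = 1 := by
    intro k
    induction k with
    | zero => exact h
    | succ k ih =>
      have hN := two_le_branching hp hm_pos hm (n + k)
      rw [← add_assoc, ← sectionsB_of_last (x := ⟨branching p m (n + k) - 1, by omega⟩)
        (by simp only; omega)]
      exact hsect _ ih _
  obtain ⟨i, hi⟩ := he_nonzero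
  have hle : p ^ m 0 ≤ branching p m (n + j) :=
    Nat.pow_le_pow_right hp.pos (hm.monotone (Nat.zero_le _))
  -- Depth `j` suffices: the order `p ^ m (n + j + 1)` of `a_{n+j+1}` exceeds `j`, yet it would have
  -- to divide `e i * j` with `e i` prime to `p`.
  have h1 := hsect _ (hall j) ⟨i, by omega⟩
  rw [sectionsB_of_lt hm hp.pos i.2, ← zpow_natCast, ← zpow_mul, ← orderOf_dvd_iff_zpow_eq_one,
    orderOf_genA (two_le_branching hp hm_pos hm _)] at h1
  have hcop : IsCoprime ((branching p m (n + j + 1) : ℕ) : ℤ) (e i) := by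
    rw [branching, Nat.cast_pow]
    apply IsCoprime.pow_left
    rw [(Nat.prime_iff_prime_int.1 hp).coprime_iff_not_dvd]
    exact fun hdvd => hi (Int.modEq_zero_iff_dvd.2 hdvd)
  have h2 := Nat.le_of_dvd (Nat.pos_of_ne_zero hj) (Int.natCast_dvd_natCast.1
    (hcop.dvd_of_dvd_mul_left h1))
  have h3 : n + j + 1 < branching p m (n + j + 1) :=
    (Nat.lt_pow_self hp.one_lt).trans_le (Nat.pow_le_pow_right hp.pos (hm.id_le _))
  omega

end GGS

/-- A criterion for the weak congruence subgroup property. -/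
theorem hasWeakCSP_of_supported_below {d : ℕ → ℕ} {k : ℕ} {G : Subgroup (AutT d k)}
    {b : AutT d k} (hbG : b ∈ G) (hb : ∀ j ≠ 0, b ^ j ≠ 1)
    (hG : ∀ u : Vertex d k, ∃ R : Subgroup (AutT d k), R ≤ ⁅G, G⁆ ∧
      (∀ f ∈ R, ∀ w, ¬ u ≤ w → f w = w) ∧
      ∃ r, ∀ N : Subgroup (AutT d k), (∀ g ∈ G, ∀ h ∈ N, g * h * g⁻¹ ∈ N) → ⁅R, R⁆ ≤ N →
        ⁅G ⊓ levelStabilizer d k r, G ⊓ levelStabilizer d k r⁆ ≤ N) :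
    HasWeakCSP G := by
  intro H hH
  have hbj : (⟨b, hbG⟩ : G) ^ H.normalCore.index ∈ H.normalCore := Subgroup.pow_index_mem _ _
  obtain ⟨u, hu⟩ : ∃ u, (b ^ H.normalCore.index) u ≠ u := by
    by_contra! hc
    exact hb _ Subgroup.FiniteIndex.index_ne_zero (RelIso.ext hc)
  obtain ⟨R, hRle, hRu, r, hr⟩ := hG u
  have hnorm : ∀ g ∈ G, ∀ h ∈ H.normalCore.map G.subtype, g * h * g⁻¹ ∈
      H.normalCore.map G.subtype := by
    rintro g hg _ ⟨h, hh, rfl⟩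
    exact Subgroup.mem_map_of_mem G.subtype (H.normalCore_normal.conj_mem h hh ⟨g, hg⟩)
  -- `R` normalises the core because `R ≤ G' ≤ G`.
  have hle := hr _ hnorm (commutator_le_of_apply_ne hRu
    (fun f hf => hnorm f (G.commutator_le_self (hRle hf))) (Subgroup.mem_map_of_mem G.subtype hbj) hu)
  refine ⟨r, ?_⟩
  rw [Subgroup.commutator_le]
  intro f hf g hg
  obtain ⟨h, hh, hhe⟩ := hle (Subgroup.commutator_mem_commutator ⟨f.2, hf⟩ ⟨g.2, hg⟩)
  have hfg : h = ⁅f, g⁆ := Subtype.ext hhe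
  exact H.normalCore_le (hfg ▸ hh)

end GrowingGGS

theorem mainTheorem5 (p : ℕ) (hp : p.Prime) (hp_odd : Odd p)
    (m : ℕ → ℕ) (hm_pos : 0 < m 0) (hm : StrictMono m)
    (e : Fin (p ^ m 0 - 1) → ℤ) (he_range : ∀ i, |e i| ≤ (p : ℤ) ^ m 1 - 1)
    (he_nonzero : ∃ i, ¬ e i ≡ 0 [ZMOD p])
    (he_nonconst : ∃ i j, ¬ e i ≡ e j [ZMOD p])
    (hbranch : ∀ n : ℕ,
      Subgroup.pi Set.univ (fun _ : Fin (p ^ m n) =>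
          ⁅GrowingGGS.growingGGS p m e (n + 1), GrowingGGS.growingGGS p m e (n + 1)⁆) ≤
        GrowingGGS.psi₁Image
          ⁅GrowingGGS.growingGGS p m e n, GrowingGGS.growingGGS p m e n⁆) :
    GrowingGGS.HasWeakCSP (GrowingGGS.growingGGS p m e 0) := by
  open GrowingGGS in
  exact hasWeakCSP_of_supported_below genB_mem_growingGGS
    (fun j hj => genB_pow_ne_one hp hm_pos hm he_nonzero hj)
    (exists_subgroup_supported_below (two_le_branching hp hm_pos hm)
      (fun n x g hg => exists_mem_commutator_section_eq hp hm_pos hm he_nonconst x hg)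
      (fun n x c hc => singleHom_mem_commutator hbranch x hc))
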